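/- Let $I=(0,1)$. For $u,w\in L^1(I)$ let $|u'-w|_{\mathcal M_b(I)}\in[0,\infty]$ be the total mass on $I$ of the distribution $u'-w$ if it is a finite signed measure on $I$, and $+\infty$ otherwise; let $\|u\|_{BV(I)}=\|u\|_{L^1(I)}+|u'|_{\mathcal M_b(I)}$ and $BV(I)=\{u\in L^1(I):\|u\|_{BV(I)}<\infty\}$. For $0<s<1$ and $1\le p<\infty$ let $$|v|_{W^{s,p}(I)}=\Big(\int_I\int_I\frac{|v(x)-v(y)|^p}{|x-y|^{1+sp}}\,dx\,dy\Big)^{1/p},\qquad W^{s,p}(I)=\{v\in L^p(I): |v|_{W^{s,p}(I)}<\infty\}.$$ For an integer $k\ge1$, $u\in L^1(I)$ and $\alpha=(\alpha_0,\dots,\alpha_{k-1})\in(0,\infty)^k$ let $$|u|_{TGV^k_\alpha(I)}=\inf\Big\{\sum_{i=0}^{k-1}\alpha_i\,|v_{i-1}'-v_i|_{\mathcal M_b(I)}:\ v_{-1}=u,\ v_{k-1}=0,\ v_0,\dots,v_{k-2}\in BV(I)\Big\},$$ and for $0<s<1$ and $\alpha=(\alpha_0,\dots,\alpha_k)\in(0,\infty)^{k+1}$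 let $$|u|_{TGV^{k+s}_\alpha(I)}=\inf\Big\{\sum_{i=0}^{k-2}\alpha_i|v_{i-1}'-v_i|_{\mathcal M_b(I)}+\alpha_{k-1}|v_{k-2}'-s\,v_{k-1}|_{\mathcal M_b(I)}+\alpha_k s(1-s)|v_{k-1}|_{W^{s,1+s(1-s)}(I)}+\alpha_{k-1}s(1-s)\Big|\int_I v_{k-1}\,dx\Big|\Big\},$$ where $v_{-1}=u$ and the infimum is over $v_0,\dots,v_{k-2}\in BV(I)$ and $v_{k-1}\in W^{s,1+s(1-s)}(I)$. For $r\in\{k,k+s\}$ put $\|u\|_{BGV^r_\alpha(I)}=\|u\|_{L^1(I)}+|u|_{TGV^r_\alpha(I)}$, and let $BGV^r(I)$ be the set of $u\in L^1(I)$ with $\|u\|_{BGV^r_\alpha(I)}<\infty$ for some $\alpha$ with positive entries. **Proposition.** Let $k\ge1$ be an integer and $0<s<1$. Then $BV(I)$, $BGV^k(I)$ and $BGV^{k+s}(I)$ coincide as sets and are topologically equivalent. That is, for $r=k$ and for $r=k+s$ and for every $\alpha$ with positive entries there are constants $c,C>0$ such that $$c\,\|u\|_{BV(I)}\le\|u\|_{BGV^r_\alpha(I)}\le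 C\,\|u\|_{BV(I)}\qquad\text{for all }u\in L^1(I)$$ (with values in $[0,\infty]$). Moreover, for every $\alpha\in(0,\infty)^2$ there is a constant $C>0$ such that $|u'|_{\mathcal M_b(I)}\le C\,|u|_{TGV^{1+s}_\alpha(I)}$ for all $u\in L^1(I)$. -/

import Mathlib

open MeasureTheory Set
open scoped ENNReal ContDiff

namespace FracTGV

noncomputable section

/-- Lebesgue measure on the interval `I = (0,1)`. -/
abbrev volI : Measure ℝ := volume.restrict (Ioo (0 : ℝ) 1)

/-- The Lebesgue space `L¹(I)`, `I = (0,1)`. -/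
abbrev L1I : Type := Lp ℝ 1 volI

/-- The distribution `u' - w` on `I` is the finite signed measure `μ`:
`-∫_I u φ' dx - ∫_I w φ dx = ∫ φ dμ` for all `φ ∈ C_c^∞(I)`. The integral against `μ` is the
difference of the integrals against its positive and negative parts. Only the restriction of `μ`
to `I` matters. -/
def DerivSubIs (u w : L1I) (μ : SignedMeasure ℝ) : Prop :=
  ∀ φ : ℝ → ℝ, ContDiff ℝ ∞ φ → HasCompactSupport φ → tsupport φ ⊆ Ioo (0 : ℝ) 1 →
    -(∫ x in Ioo (0 : ℝ) 1, u x * deriv φ x) - (∫ x in Ioo (0 : ℝ) 1, w x * φ x) =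
      (∫ x, φ x ∂μ.toJordanDecomposition.posPart) - (∫ x, φ x ∂μ.toJordanDecomposition.negPart)

/-- `|u' - w|_{M_b(I)}`: the total mass on `I` of the measure `u' - w`, and `∞` if the
distribution `u' - w` is not a finite signed measure on `I`. (Two measures `μ` admitted in the
infimum agree on `I`, so the infimum is over at most one value.) -/
def derivSubMass (u w : L1I) : ℝ≥0∞ :=
  ⨅ (μ : SignedMeasure ℝ) (_ : DerivSubIs u w μ), μ.totalVariation (Ioo (0 : ℝ) 1)

/-- The total variation `|u'|_{M_b(I)}`. -/
def totalVar (u : L1I) : ℝ≥0∞ := derivSubMass u 0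

/-- `‖u‖_{BV(I)} = ‖u‖_{L¹(I)} + |u'|_{M_b(I)}`. -/
def bvNorm (u : L1I) : ℝ≥0∞ := ‖u‖ₑ + totalVar u

/-- `BV(I)`. -/
def BV : Set L1I := {u | bvNorm u < ⊤}

/-- The Gagliardo seminorm `|u|_{W^{s,p}(I)}`. -/
def gagliardo (s p : ℝ) (u : L1I) : ℝ≥0∞ :=
  (∫⁻ x in Ioo (0 : ℝ) 1, ∫⁻ y in Ioo (0 : ℝ) 1,
    ENNReal.ofReal (|u x - u y| ^ p / |x - y| ^ (1 + s * p))) ^ (1 / p)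

/-- `W^{s,p}(I)`, for `0 < s < 1` and `1 ≤ p < ∞`, as a subset of `L¹(I) ⊇ L^p(I)`. -/
def fracSobolev (s p : ℝ) : Set L1I :=
  {u | eLpNorm u (ENNReal.ofReal p) volI + gagliardo s p u < ⊤}

/-- The seminorm `|u|_{TGV^k_α(I)}`, `k ≥ 1`, `α = (α_0, …, α_{k-1})`. A competitor
`(v_0, …, v_{k-2})` in `BV(I)` is written as the chain `w = (u, v_0, …, v_{k-2}, 0)`. -/
def tgvInt (k : ℕ) (α : Fin k → ℝ) (u : L1I) : ℝ≥0∞ :=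
  ⨅ (w : Fin (k + 1) → L1I) (_ : w 0 = u)
    (_ : ∀ i : Fin (k + 1), i ≠ 0 → i ≠ Fin.last k → w i ∈ BV) (_ : w (Fin.last k) = 0),
    ∑ i : Fin k, ENNReal.ofReal (α i) * derivSubMass (w i.castSucc) (w i.succ)

/-- The fractional seminorm `|u|_{TGV^{k+s}_α(I)}`, `k ≥ 1`, `0 < s < 1`, `α = (α_0, …, α_k)`.
A competitor `(v_0, …, v_{k-1})`, with `v_0, …, v_{k-2}` in `BV(I)` and `v_{k-1}` in
`W^{s,1+s(1-s)}(I)`, is written as the chain `w = (u, v_0, …, v_{k-1})`. The last member of the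
chain enters the sum as `s v_{k-1}`. -/
def tgvFrac (k : ℕ) (s : ℝ) (α : Fin (k + 1) → ℝ) (u : L1I) : ℝ≥0∞ :=
  ⨅ (w : Fin (k + 1) → L1I) (_ : w 0 = u)
    (_ : ∀ i : Fin (k + 1), i ≠ 0 → i ≠ Fin.last k → w i ∈ BV)
    (_ : w (Fin.last k) ∈ fracSobolev s (1 + s * (1 - s))),
    (∑ i : Fin k, ENNReal.ofReal (α i.castSucc) *
        derivSubMass (w i.castSucc) ((if (i : ℕ) + 1 = k then s else 1) • w i.succ))
      + ENNReal.ofReal (α (Fin.last k) * (s * (1 - s))) *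
          gagliardo s (1 + s * (1 - s)) (w (Fin.last k))
      + ENNReal.ofReal (α ⟨k - 1, by omega⟩ * (s * (1 - s)) *
          |∫ x in Ioo (0 : ℝ) 1, w (Fin.last k) x|)

/-- `‖u‖_{BGV^k_α(I)}`. -/
def bgvIntNorm (k : ℕ) (α : Fin k → ℝ) (u : L1I) : ℝ≥0∞ := ‖u‖ₑ + tgvInt k α u

/-- `‖u‖_{BGV^{k+s}_α(I)}`. -/
def bgvFracNorm (k : ℕ) (s : ℝ) (α : Fin (k + 1) → ℝ) (u : L1I) : ℝ≥0∞ := ‖u‖ₑ + tgvFrac k s α u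

/-- `BGV^k(I)`: finite `BGV^k_α(I)` norm for some positive weights. -/
def BGVInt (k : ℕ) : Set L1I :=
  {u | ∃ α : Fin k → ℝ, (∀ i, 0 < α i) ∧ bgvIntNorm k α u < ⊤}

/-- `BGV^{k+s}(I)`: finite `BGV^{k+s}_α(I)` norm for some positive weights. -/
def BGVFrac (k : ℕ) (s : ℝ) : Set L1I :=
  {u | ∃ α : Fin (k + 1) → ℝ, (∀ i, 0 < α i) ∧ bgvFracNorm k s α u < ⊤}

/-- Two extended norms on `L¹(I)` are equivalent (in particular finite at the same `u`). -/
def EquivNorms (N M : L1I → ℝ≥0∞) : Prop :=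
  ∃ c C : ℝ, 0 < c ∧ 0 < C ∧
    ∀ u : L1I, ENNReal.ofReal c * M u ≤ N u ∧ N u ≤ ENNReal.ofReal C * M u

end

end FracTGV

namespace FracTGV

/-! The chain `(u, 0, …, 0)` bounds both seminorms by `α 0` times `|u'|`, which is the upper
estimate.

For the lower one, take a chain `w₀ = u, w₁, …, wₖ` whose masses `|wᵢ' - wᵢ₊₁|` are at most `E`,
with `‖u‖ ≤ E`. Since `wᵢ₊₁ = wᵢ' - (wᵢ' - wᵢ₊₁)`, integrating by parts repeatedly puts the
derivatives on a fixed test function `φ` and bounds every `∫ wⱼ φ` by a multiple of `E`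
(`exists_enorm_integral_mul_le`). If `∫ φ = 1`, Poincaré's inequality `‖w‖ ≤ |∫ w φ| + C |w'|`
holds. So a bound on `‖wⱼ₊₁‖` gives one on `|wⱼ'|` by the triangle inequality
(`totalVar_le_derivSubMass_add`), hence one on `‖wⱼ‖`; descending to `j = 0` bounds `|u'|`
(`exists_totalVar_le`). The descent starts from `wₖ = 0` in the integer case, and from the
fractional Poincaré inequality `enorm_le_integral_mul_add_gagliardo` in the other.

For `TGV^{1+s}` alone, the fractional inequality with `φ = 1` uses the mean of `v₀`, which is part
of the seminorm, so `‖u‖` is not needed. -/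

instance isProbabilityMeasure_volI : IsProbabilityMeasure volI := ⟨by simp⟩

/-! ### Test functions on `I` -/

/-- Smooth functions with compact support in `(0,1)`. -/
def IsTest (φ : ℝ → ℝ) : Prop :=
  ContDiff ℝ ∞ φ ∧ HasCompactSupport φ ∧ tsupport φ ⊆ Ioo (0 : ℝ) 1

protected lemma IsTest.deriv {φ : ℝ → ℝ} (h : IsTest φ) : IsTest (deriv φ) :=
  ⟨(contDiff_infty_iff_deriv.1 h.1).2, h.2.1.deriv, tsupport_deriv_subset.trans h.2.2⟩

lemma IsTest.integrable {φ : ℝ → ℝ} (h : IsTest φ) (ν : Measure ℝ) [IsFiniteMeasure ν] :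
    Integrable φ ν :=
  h.1.continuous.integrable_of_hasCompactSupport h.2.1

lemma IsTest.exists_bound {φ : ℝ → ℝ} (h : IsTest φ) : ∃ M : ℝ, 0 < M ∧ ∀ x, |φ x| ≤ M := by
  obtain ⟨M, hM⟩ := h.2.1.exists_bound_of_continuous h.1.continuous
  exact ⟨M + 1, by linarith [(norm_nonneg _).trans (hM 0)], fun x => (hM x).trans (by linarith)⟩

lemma IsTest.eq_zero {φ : ℝ → ℝ} (h : IsTest φ) {x : ℝ} (hx : x ∉ Ioo (0 : ℝ) 1) : φ x = 0 :=
  image_eq_zero_of_notMem_tsupport fun h' => hx (h.2.2 h')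

lemma integrable_coe (u : L1I) : Integrable u volI := L1.integrable_coeFn u

lemma integrable_mul_test (u : L1I) {φ : ℝ → ℝ} (h : IsTest φ) :
    Integrable (fun x => u x * φ x) volI := by
  obtain ⟨M, -, hM⟩ := h.exists_bound
  exact (integrable_coe u).mul_bdd h.1.continuous.aestronglyMeasurable (ae_of_all _ hM)

lemma enorm_eq_lintegral (u : L1I) : ‖u‖ₑ = ∫⁻ x in Ioo (0 : ℝ) 1, ‖u x‖ₑ := by
  rw [Lp.enorm_def, eLpNorm_one_eq_lintegral_enorm]

lemma enorm_integral_mul_le (u : L1I) {φ : ℝ → ℝ} {M : ℝ} (hM : ∀ x, |φ x| ≤ M) :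
    ‖∫ x in Ioo (0 : ℝ) 1, u x * φ x‖ₑ ≤ ENNReal.ofReal M * ‖u‖ₑ := by
  rw [enorm_eq_lintegral, ← lintegral_const_mul' _ _ ENNReal.ofReal_ne_top]
  refine (enorm_integral_le_lintegral_enorm _).trans (lintegral_mono fun x => ?_)
  rw [enorm_mul, mul_comm]
  gcongr
  rw [Real.enorm_eq_ofReal_abs]
  exact ENNReal.ofReal_le_ofReal (hM x)

/-! ### Signed measures and the mass of `u' - w` -/

/-- The integral of a function against a signed measure, through the Jordan decomposition. -/
noncomputable def pairing (μ : SignedMeasure ℝ) (φ : ℝ → ℝ) : ℝ :=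
  (∫ x, φ x ∂μ.toJordanDecomposition.posPart) - (∫ x, φ x ∂μ.toJordanDecomposition.negPart)

/-- The Jordan parts of `σ` satisfy `σ⁺ + ν₂ = ν₁ + σ⁻` as positive measures, so `ν₁` and `ν₂` need
not be mutually singular. -/
lemma pairing_toSignedMeasure_sub (ν₁ ν₂ : Measure ℝ) [IsFiniteMeasure ν₁] [IsFiniteMeasure ν₂]
    {φ : ℝ → ℝ} (h : IsTest φ) :
    pairing (ν₁.toSignedMeasure - ν₂.toSignedMeasure) φ = (∫ x, φ x ∂ν₁) - ∫ x, φ x ∂ν₂ := by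
  set σ := ν₁.toSignedMeasure - ν₂.toSignedMeasure with hσ
  have h1 := σ.toSignedMeasure_toJordanDecomposition
  rw [JordanDecomposition.toSignedMeasure, hσ, sub_eq_sub_iff_add_eq_add, ← hσ,
    ← Measure.toSignedMeasure_add, ← Measure.toSignedMeasure_add,
    Measure.toSignedMeasure_eq_toSignedMeasure_iff] at h1
  have h2 := congrArg (fun ν : Measure ℝ => ∫ x, φ x ∂ν) h1
  beta_reduce at h2
  rw [integral_add_measure (h.integrable _) (h.integrable _),
    integral_add_measure (h.integrable _) (h.integrable _)] at h2
  rw [pairing]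
  linarith

lemma abs_pairing_le (μ : SignedMeasure ℝ) {φ : ℝ → ℝ} (h : IsTest φ) {M : ℝ}
    (hM : ∀ x, |φ x| ≤ M) :
    ‖pairing μ φ‖ₑ ≤ ENNReal.ofReal M * μ.totalVariation (Ioo (0 : ℝ) 1) := by
  have key : ∀ ν : Measure ℝ, ‖∫ x, φ x ∂ν‖ₑ ≤ ENNReal.ofReal M * ν (Ioo (0 : ℝ) 1) := by
    intro ν
    rw [← setIntegral_eq_integral_of_forall_compl_eq_zero (s := Ioo (0 : ℝ) 1)
      fun x hx => h.eq_zero hx]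
    refine (enorm_integral_le_lintegral_enorm _).trans ?_
    rw [← setLIntegral_const]
    refine lintegral_mono fun x => ?_
    rw [Real.enorm_eq_ofReal_abs]
    exact ENNReal.ofReal_le_ofReal (hM x)
  rw [SignedMeasure.totalVariation, Measure.add_apply, mul_add]
  exact (enorm_sub_le).trans (add_le_add (key _) (key _))

lemma derivSubIs_iff {u w : L1I} {μ : SignedMeasure ℝ} :
    DerivSubIs u w μ ↔ ∀ φ, IsTest φ →
      -(∫ x in Ioo (0 : ℝ) 1, u x * deriv φ x) - (∫ x in Ioo (0 : ℝ) 1, w x * φ x)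
        = pairing μ φ :=
  ⟨fun h φ hφ => h φ hφ.1 hφ.2.1 hφ.2.2, fun h φ h1 h2 h3 => h φ ⟨h1, h2, h3⟩⟩

/-- Reduces a bound by the mass to a bound for each admissible measure. If there is none, the mass
is `∞`, and `b ≠ 0` keeps the right side infinite. -/
lemma le_add_mul_derivSubMass {u w : L1I} {X a b : ℝ≥0∞} (hb0 : b ≠ 0) (hb : b ≠ ⊤)
    (h : ∀ μ, DerivSubIs u w μ → X ≤ a + b * μ.totalVariation (Ioo (0 : ℝ) 1)) :
    X ≤ a + b * derivSubMass u w := by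
  simp only [derivSubMass, ENNReal.mul_iInf_of_ne hb0 hb, ENNReal.add_iInf]
  refine le_iInf fun μ => ?_
  by_cases hμ : DerivSubIs u w μ
  · simpa [hμ] using h μ hμ
  · simp [hμ]

/-- Testing `w = u' - (u' - w)` against a smooth function. -/
lemma enorm_integral_mul_test_le (u w : L1I) {φ : ℝ → ℝ} (h : IsTest φ) {M : ℝ} (hM0 : 0 < M)
    (hM : ∀ x, |φ x| ≤ M) :
    ‖∫ x in Ioo (0 : ℝ) 1, w x * φ x‖ₑ ≤
      ‖∫ x in Ioo (0 : ℝ) 1, u x * deriv φ x‖ₑ + ENNReal.ofReal M * derivSubMass u w := by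
  refine le_add_mul_derivSubMass (by simpa using hM0) ENNReal.ofReal_ne_top fun μ hμ => ?_
  have h1 := derivSubIs_iff.1 hμ φ h
  rw [show (∫ x in Ioo (0 : ℝ) 1, w x * φ x) =
    -(∫ x in Ioo (0 : ℝ) 1, u x * deriv φ x) - pairing μ φ by linarith]
  refine enorm_sub_le.trans ?_
  rw [enorm_neg]
  gcongr
  exact abs_pairing_le μ h hM

lemma zero_integral_mul (φ : ℝ → ℝ) : (∫ x in Ioo (0 : ℝ) 1, (0 : L1I) x * φ x) = 0 := by
  simp

lemma enorm_integral_mul_deriv_le (u : L1I) {φ : ℝ → ℝ} (h : IsTest φ) {M : ℝ} (hM0 : 0 < M)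
    (hM : ∀ x, |φ x| ≤ M) :
    ‖∫ x in Ioo (0 : ℝ) 1, u x * deriv φ x‖ₑ ≤ ENNReal.ofReal M * totalVar u := by
  rw [← zero_add (ENNReal.ofReal M * totalVar u)]
  refine le_add_mul_derivSubMass (by simpa using hM0) ENNReal.ofReal_ne_top fun μ hμ => ?_
  have h1 := derivSubIs_iff.1 hμ φ h
  rw [zero_integral_mul, sub_zero] at h1
  rw [← enorm_neg, h1, zero_add]
  exact abs_pairing_le μ h hM

lemma totalVariation_add_le (μ ν : SignedMeasure ℝ) :
    (μ + ν).totalVariation ≤ μ.totalVariation + ν.totalVariation := by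
  simp only [SignedMeasure.totalVariation_eq_variation]
  exact VectorMeasure.variation_add_le

/-- `|u'| ≤ |u' - w| + ‖w‖`. -/
lemma totalVar_le_derivSubMass_add (u w : L1I) : totalVar u ≤ derivSubMass u w + ‖w‖ₑ := by
  rw [add_comm, ← one_mul (derivSubMass u w)]
  refine le_add_mul_derivSubMass one_ne_zero ENNReal.one_ne_top fun μ hμ => ?_
  rw [one_mul]
  have hw := integrable_coe w
  have hfin : ∀ f : ℝ → ℝ, Integrable f volI →
      IsFiniteMeasure (volI.withDensity fun x => ENNReal.ofReal (f x)) := fun f hf =>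
    isFiniteMeasure_withDensity_ofReal hf.2
  have := hfin _ hw
  have : IsFiniteMeasure (volI.withDensity fun x => ENNReal.ofReal (-w x)) := hfin _ hw.neg
  set p := volI.withDensity fun x => ENNReal.ofReal (w x) with hp
  set n := volI.withDensity fun x => ENNReal.ofReal (-w x) with hn
  have hdens : ∀ φ, IsTest φ →
      (∫ x, φ x ∂p) - ∫ x, φ x ∂n = ∫ x in Ioo (0 : ℝ) 1, w x * φ x := by
    intro φ hφ
    obtain ⟨M, -, hM⟩ := hφ.exists_bound
    have hm := hw.aestronglyMeasurable.aemeasurable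
    have hm' : AEMeasurable (fun x => -w x) volI := hm.neg
    rw [hp, hn, integral_withDensity_eq_integral_toReal_smul₀ hm.ennreal_ofReal (by simp),
      integral_withDensity_eq_integral_toReal_smul₀ hm'.ennreal_ofReal (by simp),
      ← integral_sub]
    · refine integral_congr_ae (ae_of_all _ fun x => ?_)
      simp only [ENNReal.toReal_ofReal', smul_eq_mul]
      rcases le_total 0 (w x) with h | h
      · simp [h]
      · simp [h]
    · simp only [ENNReal.toReal_ofReal', smul_eq_mul]
      exact hw.pos_part.mul_bdd hφ.1.continuous.aestronglyMeasurable (ae_of_all _ hM)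
    · simp only [ENNReal.toReal_ofReal', smul_eq_mul]
      exact hw.neg.pos_part.mul_bdd hφ.1.continuous.aestronglyMeasurable (ae_of_all _ hM)
  -- From `u' - w = μ` follows `u' = μ + w dx`, and `w dx = p - n` with `p`, `n` of densities `w⁺`,
  -- `w⁻`.
  have hσ : DerivSubIs u 0 (μ + (p.toSignedMeasure - n.toSignedMeasure)) := by
    refine derivSubIs_iff.2 fun φ hφ => ?_
    have h1 := derivSubIs_iff.1 hμ φ hφ
    have h2 := μ.toSignedMeasure_toJordanDecomposition
    rw [JordanDecomposition.toSignedMeasure] at h2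
    have h3 : μ + (p.toSignedMeasure - n.toSignedMeasure) =
        (μ.toJordanDecomposition.posPart + p).toSignedMeasure -
          (μ.toJordanDecomposition.negPart + n).toSignedMeasure := by
      rw [Measure.toSignedMeasure_add, Measure.toSignedMeasure_add]
      nth_rewrite 1 [← h2]
      abel
    rw [h3, pairing_toSignedMeasure_sub _ _ hφ, integral_add_measure (hφ.integrable _)
      (hφ.integrable _), integral_add_measure (hφ.integrable _) (hφ.integrable _),
      zero_integral_mul]
    have h4 := hdens φ hφ
    rw [pairing] at h1
    linarith
  refine (iInf₂_le _ hσ).trans ?_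
  refine (totalVariation_add_le _ _ _).trans ?_
  rw [Measure.add_apply, add_comm]
  gcongr
  rw [SignedMeasure.totalVariation_eq_variation]
  refine (VectorMeasure.variation_sub_le _).trans ?_
  rw [Measure.variation_toSignedMeasure, Measure.variation_toSignedMeasure, Measure.add_apply,
    enorm_eq_lintegral, hp, hn, withDensity_apply _ measurableSet_Ioo,
    withDensity_apply _ measurableSet_Ioo, Measure.restrict_restrict measurableSet_Ioo, inter_self,
    ← lintegral_add_left' hw.aestronglyMeasurable.aemeasurable.ennreal_ofReal]
  refine lintegral_mono fun x => ?_
  rw [Real.enorm_eq_ofReal_abs]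
  rcases le_total 0 (w x) with h | h
  · simp [abs_of_nonneg h, ENNReal.ofReal_of_nonpos (neg_nonpos.2 h)]
  · simp [abs_of_nonpos h, ENNReal.ofReal_of_nonpos h]

/-! ### Primitives, cutoffs, density and duality -/

lemma IsTest.exists_Icc {φ : ℝ → ℝ} (h : IsTest φ) :
    ∃ a b : ℝ, 0 < a ∧ b < 1 ∧ tsupport φ ⊆ Icc a b := by
  -- The extra point `1 / 2` keeps the set nonempty when `φ = 0`.
  have hK : IsCompact (insert (1 / 2 : ℝ) (tsupport φ)) := h.2.1.isCompact.insert _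
  have hsub : insert (1 / 2 : ℝ) (tsupport φ) ⊆ Ioo 0 1 :=
    insert_subset (by norm_num) h.2.2
  obtain ⟨a, ha, ha'⟩ := hK.exists_isLeast (insert_nonempty _ _)
  obtain ⟨b, hb, hb'⟩ := hK.exists_isGreatest (insert_nonempty _ _)
  exact ⟨a, b, (hsub ha).1, (hsub hb).2,
    fun x hx => ⟨ha' (mem_insert_of_mem _ hx), hb' (mem_insert_of_mem _ hx)⟩⟩

/-- A test function of mean zero has an antiderivative that is a test function. -/
lemma IsTest.exists_antideriv {ψ : ℝ → ℝ} (h : IsTest ψ)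
    (h0 : (∫ x in Ioo (0 : ℝ) 1, ψ x) = 0) {M : ℝ} (hM : ∀ x, |ψ x| ≤ M) :
    ∃ Φ, IsTest Φ ∧ deriv Φ = ψ ∧ ∀ x, |Φ x| ≤ M := by
  obtain ⟨a, b, ha, hb, hab⟩ := h.exists_Icc
  have hc := h.1.continuous
  set Φ : ℝ → ℝ := fun x => ∫ t in (0 : ℝ)..x, ψ t with hΦ
  have hder : ∀ x, HasDerivAt Φ (ψ x) x := fun x => hc.integral_hasStrictDerivAt 0 x |>.hasDerivAt
  have hderiv : deriv Φ = ψ := funext fun x => (hder x).deriv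
  have hz : ∀ x, x ∉ Icc a b → ψ x = 0 := fun x hx =>
    image_eq_zero_of_notMem_tsupport fun h' => hx (hab h')
  have hzero : ∀ x, x ∉ Icc a b → Φ x = 0 := by
    intro x hx
    rw [mem_Icc, not_and_or, not_le, not_le] at hx
    rcases hx with hx | hx
    · refine intervalIntegral.integral_zero_ae (ae_of_all _ fun t ht => ?_)
      exact hz t fun h' => absurd (h'.1.trans ht.2) (by simp [ha, hx])
    -- To the right of the support, the primitive from `0` equals the full integral, which is zero.
    · have h1 : (∫ t in (0 : ℝ)..1, ψ t) = 0 := by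
        rw [intervalIntegral.integral_of_le zero_le_one, integral_Ioc_eq_integral_Ioo, h0]
      rw [hΦ]
      beta_reduce
      rw [← intervalIntegral.integral_add_adjacent_intervals (hc.intervalIntegrable 0 1)
        (hc.intervalIntegrable 1 x), h1, zero_add]
      refine intervalIntegral.integral_zero_ae (ae_of_all _ fun t ht => ?_)
      exact hz t fun h' => absurd (ht.1.trans_le h'.2) (by simp [hb.le, hx.le])
  have hsupp : tsupport Φ ⊆ Icc a b :=
    closure_minimal (fun x hx => by_contra fun h' => hx (hzero x h')) isClosed_Icc
  refine ⟨Φ, ⟨contDiff_infty_iff_deriv.2 ⟨fun x => (hder x).differentiableAt, hderiv ▸ h.1⟩,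
    isCompact_Icc.of_isClosed_subset (isClosed_tsupport _) hsupp,
    hsupp.trans fun x hx => ⟨ha.trans_le hx.1, hx.2.trans_lt hb⟩⟩, hderiv, fun x => ?_⟩
  by_cases hx : x ∈ Icc a b
  · refine (intervalIntegral.norm_integral_le_of_norm_le_const fun t _ =>
      (Real.norm_eq_abs _).trans_le (hM t)).trans ?_
    rw [sub_zero, abs_of_pos (ha.trans_le hx.1)]
    exact mul_le_of_le_one_right ((abs_nonneg _).trans (hM 0)) (hx.2.trans hb.le)
  · rw [hzero x hx, abs_zero]
    exact (abs_nonneg _).trans (hM 0)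

lemma exists_isTest_cutoff {η : ℝ} (hη : 0 < η) (hη' : η < 1 / 2) :
    ∃ χ, IsTest χ ∧ (∀ x, 0 ≤ χ x) ∧ (∀ x, χ x ≤ 1) ∧ ∀ x ∈ Icc η (1 - η), χ x = 1 := by
  let f : ContDiffBump (1 / 2 : ℝ) := ⟨1 / 2 - η, 1 / 2 - η / 2, by linarith, by linarith⟩
  refine ⟨f, ⟨f.contDiff, f.hasCompactSupport, ?_⟩, fun x => f.nonneg, fun x => f.le_one,
    fun x hx => f.one_of_mem_closedBall ?_⟩
  · rw [f.tsupport_eq, Real.closedBall_eq_Icc]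
    change Icc (1 / 2 - (1 / 2 - η / 2)) (1 / 2 + (1 / 2 - η / 2)) ⊆ _
    exact fun x hx => ⟨by linarith [hx.1], by linarith [hx.2]⟩
  · rw [Real.closedBall_eq_Icc]
    change x ∈ Icc (1 / 2 - (1 / 2 - η)) (1 / 2 + (1 / 2 - η))
    exact ⟨by linarith [hx.1], by linarith [hx.2]⟩

/-- There is a test function with integral one. -/
lemma exists_isTest_integral_eq_one : ∃ φ, IsTest φ ∧ (∫ x in Ioo (0 : ℝ) 1, φ x) = 1 := by
  obtain ⟨χ, hχ, h0, h1, hone⟩ := exists_isTest_cutoff (η := 1 / 4) (by norm_num) (by norm_num)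
  have hpos : 0 < ∫ x in Ioo (0 : ℝ) 1, χ x := by
    rw [setIntegral_eq_integral_of_forall_compl_eq_zero fun x hx => hχ.eq_zero hx]
    refine hχ.1.continuous.integral_pos_of_hasCompactSupport_nonneg_nonzero hχ.2.1 h0
      (x := 1 / 2) ?_
    rw [hone _ (by constructor <;> norm_num)]
    exact one_ne_zero
  refine ⟨fun x => (∫ x in Ioo (0 : ℝ) 1, χ x)⁻¹ * χ x, ⟨contDiff_const.mul hχ.1,
    hχ.2.1.mul_left, (tsupport_mul_subset_right).trans hχ.2.2⟩, ?_⟩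
  rw [integral_const_mul, inv_mul_cancel₀ hpos.ne']

/-- Test functions are dense in `L¹(I)`. -/
lemma exists_isTest_integral_sub_le (v : L1I) {ε : ℝ} (hε : 0 < ε) :
    ∃ g, IsTest g ∧ (∫ x in Ioo (0 : ℝ) 1, |v x - g x|) ≤ ε := by
  have hv := integrable_coe v
  obtain ⟨g, hgc, hgs, hg⟩ := MemLp.exist_eLpNorm_sub_le ENNReal.one_ne_top le_rfl (Lp.memLp v)
    (half_pos hε)
  have hgi : Integrable g volI := hgs.continuous.integrable_of_hasCompactSupport hgc
  have hvg : Integrable (fun x => |v x - g x|) volI := (hv.sub hgi).abs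
  have hg' : (∫ x in Ioo (0 : ℝ) 1, |v x - g x|) ≤ ε / 2 := by
    rw [eLpNorm_one_eq_lintegral_enorm,
      ← ofReal_integral_norm_eq_lintegral_enorm (hv.sub hgi)] at hg
    exact (ENNReal.ofReal_le_ofReal_iff (half_pos hε).le).1 hg
  obtain ⟨M, hM⟩ := hgc.exists_bound_of_continuous hgs.continuous
  set G := M + 1
  have hG0 : 0 < G := by linarith [(norm_nonneg _).trans (hM 0)]
  have hG : ∀ x, |g x| ≤ G := fun x => (hM x).trans (by simp [G])
  -- The cutoff alters `g` only in two boundary layers of total length `2 * η`, at a cost of at most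
  -- `G * (2 * η) ≤ ε / 2`.
  set η := min (1 / 4) (ε / (4 * G)) with hη
  have hη0 : 0 < η := by positivity
  have hη1 : η ≤ 1 / 4 := min_le_left _ _
  have hη2 : G * (2 * η) ≤ ε / 2 := by
    have := (le_div_iff₀ (by positivity)).1 (min_le_right (1 / 4) (ε / (4 * G)))
    linarith
  obtain ⟨χ, hχ, h0, h1, hone⟩ := exists_isTest_cutoff hη0 (by linarith)
  set S : Set ℝ := (Icc η (1 - η))ᶜ
  have hS : MeasurableSet S := measurableSet_Icc.compl
  have hSm : volI.real S ≤ 2 * η := by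
    refine ENNReal.toReal_le_of_le_ofReal (by positivity) ?_
    rw [Measure.restrict_apply hS]
    calc volume (S ∩ Ioo 0 1) ≤ volume (Ioo 0 η ∪ Ioo (1 - η) 1) := by
          refine measure_mono fun x hx => ?_
          have := hx.1
          simp only [S, mem_compl_iff, mem_Icc, not_and_or, not_le] at this
          exact this.imp (fun h => ⟨hx.2.1, h⟩) fun h => ⟨h, hx.2.2⟩
      _ ≤ volume (Ioo 0 η) + volume (Ioo (1 - η) 1) := measure_union_le _ _
      _ = ENNReal.ofReal (2 * η) := by
          rw [Real.volume_Ioo, Real.volume_Ioo, ← ENNReal.ofReal_add (by linarith) (by linarith)]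
          ring_nf
  have hSi : Integrable (fun x => S.indicator (fun _ => G) x) volI :=
    (integrable_const G).indicator hS
  have hχg : IsTest fun x => χ x * g x :=
    ⟨hχ.1.mul hgs, hχ.2.1.mul_right, (tsupport_mul_subset_left).trans hχ.2.2⟩
  refine ⟨_, hχg, ?_⟩
  calc (∫ x in Ioo (0 : ℝ) 1, |v x - χ x * g x|)
      ≤ ∫ x in Ioo (0 : ℝ) 1, (|v x - g x| + S.indicator (fun _ => G) x) := by
        refine integral_mono (hv.sub (hχg.integrable _)).abs (hvg.add hSi) fun x => ?_
        by_cases hx : x ∈ S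
        · have e1 := abs_add_le (v x - g x) ((1 - χ x) * g x)
          have e2 : |(1 - χ x) * g x| ≤ G := by
            rw [abs_mul, abs_of_nonneg (by linarith [h1 x])]
            exact (mul_le_of_le_one_left (abs_nonneg _) (by linarith [h0 x])).trans (hG x)
          rw [show v x - g x + (1 - χ x) * g x = v x - χ x * g x by ring] at e1
          simp only [indicator_of_mem hx]
          linarith
        · simp [indicator_of_notMem hx, hone x (not_notMem.1 hx)]
    _ = (∫ x in Ioo (0 : ℝ) 1, |v x - g x|) + G * volI.real S := by
        rw [integral_add hvg hSi, integral_indicator_const _ hS, smul_eq_mul, mul_comm G]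
    _ ≤ ε := by
        have := mul_le_mul_of_nonneg_left hSm hG0.le
        linarith

/-- Duality: `L¹` norms are recovered from test functions bounded by one. The sign of `v` is
replaced by the test function `g / √(g² + (ε/3)²)`, where `g` is a test function close to `v`; the
square root is a smooth `|g|` with error at most `ε / 3`. -/
lemma enorm_le_of_forall_isTest (v : L1I) {B : ℝ≥0∞}
    (h : ∀ ψ, IsTest ψ → (∀ x, |ψ x| ≤ 1) → ‖∫ x in Ioo (0 : ℝ) 1, v x * ψ x‖ₑ ≤ B) :
    ‖v‖ₑ ≤ B := by
  rcases eq_or_ne B ⊤ with rfl | hB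
  · exact le_top
  have hv := integrable_coe v
  rw [enorm_eq_lintegral, ← ofReal_integral_norm_eq_lintegral_enorm hv]
  refine ENNReal.ofReal_le_of_le_toReal (le_of_forall_pos_le_add fun ε hε => ?_)
  obtain ⟨g, hg, hgε⟩ := exists_isTest_integral_sub_le v (ε := ε / 3) (by positivity)
  have hq : ∀ x, 0 < g x ^ 2 + (ε / 3) ^ 2 := fun x => by positivity
  set q : ℝ → ℝ := fun x => √(g x ^ 2 + (ε / 3) ^ 2) with hqdef
  have hq0 : ∀ x, 0 < q x := fun x => Real.sqrt_pos.2 (hq x)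
  have hq2 : ∀ x, q x ^ 2 = g x ^ 2 + (ε / 3) ^ 2 := fun x => Real.sq_sqrt (hq x).le
  have hgq : ∀ x, |g x| ≤ q x := fun x => abs_le_of_sq_le_sq (by nlinarith [hq2 x]) (hq0 x).le
  have hqg : ∀ x, q x ≤ |g x| + ε / 3 := fun x =>
    abs_le_of_sq_le_sq' (by nlinarith [hq2 x, sq_abs (g x), abs_nonneg (g x)]) (by positivity) |>.2
  have hqs : ContDiff ℝ ∞ q :=
    ((hg.1.pow 2).add contDiff_const).sqrt fun x => (hq x).ne'
  have hψ : IsTest fun x => (q x)⁻¹ * g x :=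
    ⟨(hqs.inv fun x => (hq0 x).ne').mul hg.1, hg.2.1.mul_left,
      (tsupport_mul_subset_right).trans hg.2.2⟩
  have hψ1 : ∀ x, |(q x)⁻¹ * g x| ≤ 1 := fun x => by
    rw [abs_mul, abs_of_pos (inv_pos.2 (hq0 x)), inv_mul_le_one₀ (hq0 x)]
    exact hgq x
  have hb := h _ hψ hψ1
  have hb' : (∫ x in Ioo (0 : ℝ) 1, v x * ((q x)⁻¹ * g x)) ≤ B.toReal := by
    refine (le_abs_self _).trans ?_
    rw [← Real.norm_eq_abs, ← toReal_enorm]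
    exact ENNReal.toReal_mono hB hb
  have hvg : Integrable (fun x => |v x - g x|) volI := (hv.sub (hg.integrable _)).abs
  have hpt : ∀ x, ‖v x‖ ≤ 2 * |v x - g x| + v x * ((q x)⁻¹ * g x) + ε / 3 := by
    intro x
    have e1 : |v x| ≤ |v x - g x| + |g x| := by
      simpa using abs_add_le (v x - g x) (g x)
    have e2 : |g x| ≤ g x * ((q x)⁻¹ * g x) + ε / 3 := by
      have : g x * ((q x)⁻¹ * g x) = |g x| ^ 2 / q x := by rw [sq_abs]; field_simp
      rw [this, ← sub_le_iff_le_add, le_div_iff₀ (hq0 x)]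
      nlinarith [hq2 x, sq_abs (g x), abs_nonneg (g x), hgq x, hqg x, hq0 x]
    have e3 : (g x - v x) * ((q x)⁻¹ * g x) ≤ |v x - g x| := by
      refine (le_abs_self _).trans ?_
      rw [abs_mul, abs_sub_comm]
      exact mul_le_of_le_one_right (abs_nonneg _) (hψ1 x)
    rw [Real.norm_eq_abs]
    linarith
  calc (∫ x in Ioo (0 : ℝ) 1, ‖v x‖)
      ≤ ∫ x in Ioo (0 : ℝ) 1, (2 * |v x - g x| + v x * ((q x)⁻¹ * g x) + ε / 3) :=
        integral_mono hv.norm (((hvg.const_mul 2).add (integrable_mul_test v hψ)).add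
          (integrable_const _)) hpt
    _ = 2 * (∫ x in Ioo (0 : ℝ) 1, |v x - g x|) +
          (∫ x in Ioo (0 : ℝ) 1, v x * ((q x)⁻¹ * g x)) + ε / 3 := by
        have e : Integrable (fun x => 2 * |v x - g x| + v x * ((q x)⁻¹ * g x)) volI :=
          (hvg.const_mul 2).add (integrable_mul_test v hψ)
        rw [integral_add e (integrable_const _),
          integral_add (hvg.const_mul 2) (integrable_mul_test v hψ), integral_const_mul]
        simp
    _ ≤ B.toReal + ε := by linarith

/-! ### Poincaré inequalities -/

/-- Poincaré inequality in `BV(I)`. -/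
lemma enorm_le_integral_mul_add_totalVar (v : L1I) {φ : ℝ → ℝ} (hφ : IsTest φ)
    (h1 : (∫ x in Ioo (0 : ℝ) 1, φ x) = 1) {M : ℝ} (hM0 : 0 < M) (hM : ∀ x, |φ x| ≤ M) :
    ‖v‖ₑ ≤ ‖∫ x in Ioo (0 : ℝ) 1, v x * φ x‖ₑ + ENNReal.ofReal (1 + M) * totalVar v := by
  refine enorm_le_of_forall_isTest v fun ψ hψ hψ1 => ?_
  -- Subtracting `m * φ` gives `ψ` mean zero, so that the difference is the derivative of a test
  -- function and pairs with `v` through `v'`.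
  set m := ∫ x in Ioo (0 : ℝ) 1, ψ x with hm
  have hm1 : |m| ≤ 1 := by
    simpa using norm_integral_le_of_norm_le_const (μ := volI) (ae_of_all _ fun x => (Real.norm_eq_abs _).trans_le (hψ1 x))
  have hmφ : IsTest fun x => m * φ x :=
    ⟨contDiff_const.mul hφ.1, hφ.2.1.mul_left, (tsupport_mul_subset_right).trans hφ.2.2⟩
  have hg : IsTest fun x => ψ x - m * φ x :=
    ⟨hψ.1.sub hmφ.1, hψ.2.1.sub hmφ.2.1,
      (tsupport_sub ψ fun x => m * φ x).trans (union_subset hψ.2.2 hmφ.2.2)⟩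
  have hg0 : (∫ x in Ioo (0 : ℝ) 1, (ψ x - m * φ x)) = 0 := by
    rw [integral_sub (hψ.integrable _) (hmφ.integrable _), integral_const_mul, h1]
    ring
  have hgM : ∀ x, |ψ x - m * φ x| ≤ 1 + M := fun x => by
    refine (abs_sub _ _).trans (add_le_add (hψ1 x) ?_)
    rw [abs_mul]
    exact (mul_le_of_le_one_left (abs_nonneg _) hm1).trans (hM x)
  obtain ⟨Φ, hΦ, hΦd, hΦM⟩ := hg.exists_antideriv hg0 hgM
  have key : (∫ x in Ioo (0 : ℝ) 1, v x * ψ x) =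
      m * (∫ x in Ioo (0 : ℝ) 1, v x * φ x) + ∫ x in Ioo (0 : ℝ) 1, v x * deriv Φ x := by
    rw [← integral_const_mul, ← integral_add ((integrable_mul_test v hφ).const_mul m)
      (integrable_mul_test v hΦ.deriv), hΦd]
    exact integral_congr_ae (ae_of_all _ fun x => by ring)
  rw [key]
  refine (enorm_add_le _ _).trans (add_le_add ?_
    (enorm_integral_mul_deriv_le v hΦ (by linarith) hΦM))
  rw [enorm_mul]
  refine mul_le_of_le_one_left' ?_
  rw [Real.enorm_eq_ofReal_abs]
  exact ENNReal.ofReal_le_one.2 hm1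

/-- `L¹` norms are at most `Lᵖ` norms on the probability space `I × I`, and there `|x - y| ≤ 1`, so
the Gagliardo denominator only increases the integrand. -/
lemma lintegral_enorm_sub_le_gagliardo {s p : ℝ} (hs : 0 ≤ s) (hp : 1 ≤ p) (v : L1I) :
    (∫⁻ x in Ioo (0 : ℝ) 1, ∫⁻ y in Ioo (0 : ℝ) 1, ‖v x - v y‖ₑ) ≤ gagliardo s p v := by
  have hp0 : 0 < p := zero_lt_one.trans_le hp
  have hv : Measurable v := (Lp.stronglyMeasurable v).measurable
  have hm : Measurable fun z : ℝ × ℝ => v z.1 - v z.2 :=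
    (hv.comp measurable_fst).sub (hv.comp measurable_snd)
  have h := eLpNorm_le_eLpNorm_of_exponent_le (p := 1) (q := ENNReal.ofReal p)
    (μ := volI.prod volI) (ENNReal.one_le_ofReal.2 hp) hm.aestronglyMeasurable
  rw [eLpNorm_one_eq_lintegral_enorm,
    eLpNorm_eq_lintegral_rpow_enorm_toReal (by simpa using hp0) ENNReal.ofReal_ne_top,
    ENNReal.toReal_ofReal hp0.le, lintegral_prod _ hm.enorm.aemeasurable,
    lintegral_prod _ (hm.enorm.pow_const p).aemeasurable] at h
  refine h.trans ?_
  rw [gagliardo]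
  gcongr ?_ ^ _
  refine setLIntegral_mono' measurableSet_Ioo fun x hx =>
    setLIntegral_mono' measurableSet_Ioo fun y hy => ?_
  rw [Real.enorm_eq_ofReal_abs, ENNReal.ofReal_rpow_of_nonneg (abs_nonneg _) hp0.le]
  refine ENNReal.ofReal_le_ofReal ?_
  rcases eq_or_ne x y with rfl | hxy
  · simp [hp0.ne']
  · have hd : 0 < |x - y| := abs_pos.2 (sub_ne_zero.2 hxy)
    rw [le_div_iff₀ (Real.rpow_pos_of_pos hd _)]
    refine mul_le_of_le_one_right (by positivity) (Real.rpow_le_one hd.le ?_ (by positivity))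
    exact abs_le.2 ⟨by linarith [hx.1, hy.2], by linarith [hx.2, hy.1]⟩

/-- Fractional Poincaré inequality. -/
lemma enorm_le_integral_mul_add_gagliardo {s p : ℝ} (hs : 0 ≤ s) (hp : 1 ≤ p) (v : L1I)
    {φ : ℝ → ℝ} (hφ : Continuous φ) (h1 : (∫ x in Ioo (0 : ℝ) 1, φ x) = 1) {M : ℝ}
    (hM : ∀ x, |φ x| ≤ M) :
    ‖v‖ₑ ≤ ‖∫ x in Ioo (0 : ℝ) 1, v x * φ x‖ₑ + ENNReal.ofReal M * gagliardo s p v := by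
  have hv := integrable_coe v
  have hφi : Integrable φ volI :=
    Integrable.of_bound hφ.aestronglyMeasurable M (ae_of_all _ hM)
  have hvφ : Integrable (fun x => v x * φ x) volI :=
    hv.mul_bdd hφ.aestronglyMeasurable (ae_of_all _ hM)
  have hpt : ∀ x, ‖v x‖ₑ ≤ ‖∫ y in Ioo (0 : ℝ) 1, v y * φ y‖ₑ +
      ENNReal.ofReal M * ∫⁻ y in Ioo (0 : ℝ) 1, ‖v x - v y‖ₑ := by
    intro x
    -- As `∫ φ = 1`, `v x` is the `φ`-average of `v` plus the `φ`-average of `v x - v y`.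
    have e : v x = (∫ y in Ioo (0 : ℝ) 1, v y * φ y) +
        ∫ y in Ioo (0 : ℝ) 1, (v x - v y) * φ y := by
      simp only [sub_mul]
      rw [integral_sub (hφi.const_mul _) hvφ, integral_const_mul, h1]
      ring
    nth_rewrite 1 [e]
    refine (enorm_add_le _ _).trans (add_le_add le_rfl ?_)
    refine (enorm_integral_le_lintegral_enorm _).trans ?_
    rw [← lintegral_const_mul' _ _ ENNReal.ofReal_ne_top]
    refine lintegral_mono fun y => ?_
    rw [enorm_mul, mul_comm]
    gcongr
    rw [Real.enorm_eq_ofReal_abs]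
    exact ENNReal.ofReal_le_ofReal (hM y)
  rw [enorm_eq_lintegral]
  refine (lintegral_mono hpt).trans ?_
  rw [lintegral_add_left measurable_const, lintegral_const_mul' _ _ ENNReal.ofReal_ne_top,
    lintegral_const, measure_univ, mul_one]
  gcongr
  exact lintegral_enorm_sub_le_gagliardo hs hp v

/-! ### Estimates along chains -/

/-- Along a chain `w₀, w₁, …`, the pairing of `wⱼ` with a test function is controlled by `‖w₀‖` and
the masses `|wᵢ' - wᵢ₊₁|`, `i < j`. -/
lemma exists_enorm_integral_mul_le (j : ℕ) : ∀ φ, IsTest φ → ∃ C : NNReal,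
    ∀ (w : ℕ → L1I) (E : ℝ≥0∞), ‖w 0‖ₑ ≤ E → (∀ i < j, derivSubMass (w i) (w (i + 1)) ≤ E) →
      ‖∫ x in Ioo (0 : ℝ) 1, w j x * φ x‖ₑ ≤ C * E := by
  induction j with
  | zero =>
    intro φ hφ
    obtain ⟨M, -, hM⟩ := hφ.exists_bound
    refine ⟨M.toNNReal, fun w E h0 _ => (enorm_integral_mul_le _ hM).trans ?_⟩
    exact mul_le_mul_right h0 _
  | succ j ih =>
    intro φ hφ
    obtain ⟨M, hM0, hM⟩ := hφ.exists_bound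
    -- One step down the chain costs one derivative on the test function, so the induction ranges
    -- over all test functions.
    obtain ⟨C, hC⟩ := ih _ hφ.deriv
    refine ⟨C + M.toNNReal, fun w E h0 hm =>
      (enorm_integral_mul_test_le (w j) (w (j + 1)) hφ hM0 hM).trans ?_⟩
    rw [ENNReal.coe_add, add_mul]
    exact add_le_add (hC w E h0 fun i hi => hm i (hi.trans j.lt_succ_self))
      (mul_le_mul_right (hm j j.lt_succ_self) _)

/-- The total variation of the first member of a chain `w₀, …, wₖ` is controlled by `‖w₀‖`, `‖wₖ‖`
and the masses `|wᵢ' - wᵢ₊₁|`. -/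
lemma exists_totalVar_le (k : ℕ) (hk : 1 ≤ k) : ∃ C : NNReal,
    ∀ (w : ℕ → L1I) (E : ℝ≥0∞), ‖w 0‖ₑ ≤ E → ‖w k‖ₑ ≤ E →
      (∀ i < k, derivSubMass (w i) (w (i + 1)) ≤ E) → totalVar (w 0) ≤ C * E := by
  obtain ⟨φ, hφ, h1⟩ := exists_isTest_integral_eq_one
  obtain ⟨M, hM0, hM⟩ := hφ.exists_bound
  induction k, hk using Nat.le_induction with
  | base =>
    refine ⟨2, fun w E _ hk hm => (totalVar_le_derivSubMass_add _ (w 1)).trans ?_⟩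
    rw [ENNReal.coe_ofNat, two_mul]
    exact add_le_add (hm 0 zero_lt_one) hk
  | succ k hk ih =>
    obtain ⟨C, hC⟩ := ih
    obtain ⟨D, hD⟩ := exists_enorm_integral_mul_le k φ hφ
    -- `D` bounds `∫ wₖ φ`, `(1 + M) * 2` comes from Poincaré with `|wₖ'| ≤ 2 E`, and `1` ensures `E
    -- ≤ K * E`. The shorter chain `w₀, …, wₖ` then satisfies the hypotheses with `K * E` for `E`.
    set K : NNReal := D + (1 + M).toNNReal * 2 + 1 with hK
    refine ⟨C * K, fun w E h0 hk' hm => ?_⟩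
    have hm' : ∀ i < k, derivSubMass (w i) (w (i + 1)) ≤ E := fun i hi => hm i (by omega)
    have hE : E ≤ K * E := by
      refine le_mul_of_one_le_left' ?_
      exact_mod_cast le_add_self
    have htv : totalVar (w k) ≤ 2 * E := by
      refine (totalVar_le_derivSubMass_add _ (w (k + 1))).trans ?_
      rw [two_mul]
      exact add_le_add (hm k k.lt_succ_self) hk'
    have hwk : ‖w k‖ₑ ≤ K * E := by
      refine (enorm_le_integral_mul_add_totalVar (w k) hφ h1 hM0 hM).trans ?_
      calc _ ≤ D * E + (1 + M).toNNReal * (2 * E) :=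
            add_le_add (hD w E h0 hm') (mul_le_mul_right htv _)
        _ ≤ D * E + (1 + M).toNNReal * (2 * E) + 1 * E := le_self_add
        _ = K * E := by rw [hK]; push_cast; ring
    rw [ENNReal.coe_mul, mul_assoc]
    exact hC w (K * E) (h0.trans hE) hwk fun i hi => (hm' i hi).trans hE

/-! ### Weights and the trivial competitor -/

lemma exists_forall_le_mul {ι : Type*} [Finite ι] (α : ι → ℝ) (hα : ∀ i, 0 < α i) :
    ∃ A : NNReal, 1 ≤ A ∧ ∀ i (x : ℝ≥0∞), x ≤ A * (ENNReal.ofReal (α i) * x) := by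
  have := Fintype.ofFinite ι
  refine ⟨1 + ∑ i, (α i).toNNReal⁻¹, le_self_add, fun i x => ?_⟩
  rw [← mul_assoc]
  refine le_mul_of_one_le_left' ?_
  have h : (α i).toNNReal⁻¹ ≤ 1 + ∑ i, (α i).toNNReal⁻¹ :=
    (Finset.single_le_sum (f := fun i => (α i).toNNReal⁻¹) (fun _ _ => zero_le)
      (Finset.mem_univ i)).trans le_add_self
  have h0 : (α i).toNNReal ≠ 0 := by simpa using hα i
  rw [ENNReal.ofReal, ← ENNReal.coe_mul, ENNReal.one_le_coe_iff]
  exact (inv_mul_cancel₀ h0).ge.trans (mul_le_mul_left h _)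

lemma derivSubMass_zero_zero : derivSubMass 0 0 = 0 := by
  refine le_antisymm ((iInf₂_le (0 : SignedMeasure ℝ) ?_).trans ?_) zero_le
  · refine derivSubIs_iff.2 fun φ _ => ?_
    simp [pairing, SignedMeasure.toJordanDecomposition_zero]
  · simp [SignedMeasure.totalVariation_zero]

lemma zero_mem_BV : (0 : L1I) ∈ BV := by
  simp [BV, bvNorm, totalVar, derivSubMass_zero_zero]

lemma gagliardo_zero {s p : ℝ} (hp : 0 < p) : gagliardo s p 0 = 0 := by
  simp [gagliardo, hp.ne', hp]

lemma zero_mem_fracSobolev {s p : ℝ} (hp : 0 < p) : (0 : L1I) ∈ fracSobolev s p := by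
  have : eLpNorm (0 : L1I) (ENNReal.ofReal p) volI = 0 := by
    rw [eLpNorm_congr_ae (Lp.coeFn_zero ℝ 1 volI), eLpNorm_zero]
  rw [fracSobolev, mem_ofPred_eq, gagliardo_zero hp, this, add_zero]
  exact ENNReal.zero_lt_top

lemma tgvInt_le (n : ℕ) (α : Fin (n + 1) → ℝ) (u : L1I) :
    tgvInt (n + 1) α u ≤ ENNReal.ofReal (α 0) * totalVar u := by
  refine (iInf_le _ fun i => if i = 0 then u else 0).trans ?_
  refine (iInf_le _ (by simp)).trans ((iInf_le _ fun i hi _ => ?_).trans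
    ((iInf_le _ (by simp)).trans ?_))
  · simpa [hi] using zero_mem_BV
  · rw [Fin.sum_univ_succ]
    simp [derivSubMass_zero_zero, totalVar]

lemma tgvFrac_le (n : ℕ) {s : ℝ} (hs0 : 0 < s) (hs1 : s < 1) (α : Fin (n + 1 + 1) → ℝ) (u : L1I) :
    tgvFrac (n + 1) s α u ≤ ENNReal.ofReal (α 0) * totalVar u := by
  have hp : 0 < 1 + s * (1 - s) := by nlinarith
  refine (iInf_le _ fun i => if i = 0 then u else 0).trans ?_
  refine (iInf_le _ (by simp)).trans ((iInf_le _ fun i hi _ => ?_).trans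
    ((iInf_le _ ?_).trans ?_))
  · simpa [hi] using zero_mem_BV
  · simp [zero_mem_fracSobolev hp]
  · rw [Fin.sum_univ_succ]
    simp [derivSubMass_zero_zero, totalVar, gagliardo_zero hp]

/-! ### Lower bounds for a fixed chain -/

lemma bvNorm_le_mul {u : L1I} {a b : NNReal} {E F : ℝ≥0∞} (hE : E = b * F) (hu : ‖u‖ₑ ≤ E)
    (h : totalVar u ≤ a * E) : bvNorm u ≤ ((1 + a) * b : NNReal) * F := by
  rw [ENNReal.coe_mul, mul_assoc, ← hE, ENNReal.coe_add, add_mul, ENNReal.coe_one, one_mul]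
  exact add_le_add hu h

lemma exists_bvNorm_le_int (k : ℕ) (hk : 1 ≤ k) (α : Fin k → ℝ) (hα : ∀ i, 0 < α i) :
    ∃ K : NNReal, ∀ w : Fin (k + 1) → L1I, w (Fin.last k) = 0 →
      bvNorm (w 0) ≤ K * (‖w 0‖ₑ +
        ∑ i : Fin k, ENNReal.ofReal (α i) * derivSubMass (w i.castSucc) (w i.succ)) := by
  obtain ⟨A, hA1, hA⟩ := exists_forall_le_mul α hα
  obtain ⟨C, hC⟩ := exists_totalVar_le k hk
  refine ⟨(1 + C) * A, fun w hw => ?_⟩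
  set S := ∑ i : Fin k, ENNReal.ofReal (α i) * derivSubMass (w i.castSucc) (w i.succ)
  have h0 : ‖w 0‖ₑ ≤ A * (‖w 0‖ₑ + S) :=
    le_self_add.trans (le_mul_of_one_le_left' (by exact_mod_cast hA1))
  have hm : ∀ i : Fin k, derivSubMass (w i.castSucc) (w i.succ) ≤ A * (‖w 0‖ₑ + S) := fun i =>
    (hA i _).trans (mul_le_mul_right ((Finset.single_le_sum (f := fun i : Fin k =>
      ENNReal.ofReal (α i) * derivSubMass (w i.castSucc) (w i.succ)) (fun _ _ => zero_le)
      (Finset.mem_univ i)).trans le_add_self) _)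
  refine bvNorm_le_mul rfl h0 ?_
  -- The chain is extended to `ℕ` by reduction modulo `k + 1`; only indices up to `k` matter.
  refine hC (fun i => w (Fin.ofNat (k + 1) i)) _ ?_ ?_ fun i hi => ?_
  · exact h0
  · simp [hw]
  · convert hm ⟨i, hi⟩ using 2
    · congr 1; ext; simp [Nat.mod_eq_of_lt (show i < k + 1 by omega)]
    · congr 1; ext; simp [Nat.mod_eq_of_lt (show i + 1 < k + 1 by omega)]

/-- The mean of the last member does not appear: its pairing with a test function is already
controlled by `‖w 0‖` and the masses. -/
lemma exists_bvNorm_le_frac (k : ℕ) (hk : 1 ≤ k) {s : ℝ} (hs0 : 0 < s) (hs1 : s < 1)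
    (α : Fin (k + 1) → ℝ) (hα : ∀ i, 0 < α i) :
    ∃ K : NNReal, ∀ w : Fin (k + 1) → L1I,
      bvNorm (w 0) ≤ K * (‖w 0‖ₑ + ((∑ i : Fin k, ENNReal.ofReal (α i.castSucc) *
          derivSubMass (w i.castSucc) ((if (i : ℕ) + 1 = k then s else 1) • w i.succ))
        + ENNReal.ofReal (α (Fin.last k) * (s * (1 - s))) *
          gagliardo s (1 + s * (1 - s)) (w (Fin.last k)))) := by
  have hss : 0 < s * (1 - s) := mul_pos hs0 (by linarith)
  obtain ⟨φ, hφ, h1⟩ := exists_isTest_integral_eq_one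
  obtain ⟨M, hM0, hM⟩ := hφ.exists_bound
  obtain ⟨A, hA1, hA⟩ := exists_forall_le_mul α hα
  obtain ⟨B, hB1, hB⟩ := exists_forall_le_mul (fun _ : Unit => α (Fin.last k) * (s * (1 - s)))
    fun _ => mul_pos (hα _) hss
  obtain ⟨C, hC⟩ := exists_totalVar_le k hk
  obtain ⟨D, hD⟩ := exists_enorm_integral_mul_le k φ hφ
  set H : NNReal := A * B
  set L : NNReal := 1 + D + M.toNNReal with hL
  refine ⟨(1 + C) * (L * H), fun w => ?_⟩
  set S := ∑ i : Fin k, ENNReal.ofReal (α i.castSucc) *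
    derivSubMass (w i.castSucc) ((if (i : ℕ) + 1 = k then s else 1) • w i.succ)
  set G := gagliardo s (1 + s * (1 - s)) (w (Fin.last k)) with hG
  set F := ‖w 0‖ₑ + (S + ENNReal.ofReal (α (Fin.last k) * (s * (1 - s))) * G) with hF
  have hAH : A ≤ H := le_mul_of_one_le_right' hB1
  have hBH : B ≤ H := le_mul_of_one_le_left' hA1
  have hL1 : 1 ≤ L := by rw [hL, add_assoc]; exact le_self_add
  have hEL : (H : ℝ≥0∞) * F ≤ L * (H * F) := le_mul_of_one_le_left' (by exact_mod_cast hL1)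
  have h0 : ‖w 0‖ₑ ≤ H * F :=
    le_self_add.trans (le_mul_of_one_le_left' (by exact_mod_cast hA1.trans hAH))
  have hm : ∀ i : Fin k, derivSubMass (w i.castSucc)
      ((if (i : ℕ) + 1 = k then s else 1) • w i.succ) ≤ H * F := fun i =>
    (hA i.castSucc _).trans (mul_le_mul' (by exact_mod_cast hAH)
      ((Finset.single_le_sum (f := fun i : Fin k => ENNReal.ofReal (α i.castSucc) *
        derivSubMass (w i.castSucc) ((if (i : ℕ) + 1 = k then s else 1) • w i.succ))
        (fun _ _ => zero_le) (Finset.mem_univ i)).trans (le_self_add.trans le_add_self)))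
  have hg : G ≤ H * F := (hB () _).trans (mul_le_mul' (by exact_mod_cast hBH)
    (le_add_self.trans le_add_self))
  -- The factor `s` is absorbed into the last member, which makes `z` an ordinary chain.
  set z : ℕ → L1I := fun i => (if i = k then s else 1) • w (Fin.ofNat (k + 1) i) with hz
  have hz0 : z 0 = w 0 := by simp [hz, show (0 : ℕ) ≠ k by omega]
  have hzk : z k = s • w (Fin.last k) := by simp [hz]
  have hzm : ∀ i < k, derivSubMass (z i) (z (i + 1)) ≤ H * F := fun i hi => by
    convert hm ⟨i, hi⟩ using 2
    · simp only [hz, hi.ne, if_false, one_smul]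
      congr 1; ext; simp [Nat.mod_eq_of_lt (show i < k + 1 by omega)]
    · simp only [hz]
      congr 2; ext; simp [Nat.mod_eq_of_lt (show i + 1 < k + 1 by omega)]
  -- The chain controls `∫ z k φ = s ∫ wₖ φ`, so the fractional Poincaré inequality for `wₖ` is
  -- multiplied by `s`.
  have hlast : ‖z k‖ₑ ≤ L * (H * F) := by
    have e : ‖∫ x in Ioo (0 : ℝ) 1, z k x * φ x‖ₑ =
        ‖s‖ₑ * ‖∫ x in Ioo (0 : ℝ) 1, w (Fin.last k) x * φ x‖ₑ := by
      rw [← enorm_mul, ← integral_const_mul, hzk]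
      congr 1
      refine integral_congr_ae ?_
      filter_upwards [Lp.coeFn_smul s (w (Fin.last k))] with x hx
      simp [hx, mul_assoc]
    have hs : ‖s‖ₑ ≤ 1 := by
      rw [Real.enorm_eq_ofReal hs0.le]
      exact ENNReal.ofReal_le_one.2 hs1.le
    have hd := hD z (H * F) (hz0 ▸ h0) hzm
    rw [hzk, enorm_smul]
    calc ‖s‖ₑ * ‖w (Fin.last k)‖ₑ
        ≤ ‖s‖ₑ * (‖∫ x in Ioo (0 : ℝ) 1, w (Fin.last k) x * φ x‖ₑ + ENNReal.ofReal M * G) :=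
          mul_le_mul_right (enorm_le_integral_mul_add_gagliardo hs0.le (by linarith) _
            hφ.1.continuous h1 hM) _
      _ ≤ D * (H * F) + M.toNNReal * (H * F) := by
          rw [mul_add, ← e]
          exact add_le_add hd ((mul_le_of_le_one_left' hs).trans (mul_le_mul_right hg _))
      _ ≤ 1 * (H * F) + (D * (H * F) + M.toNNReal * (H * F)) := le_add_self
      _ = L * (H * F) := by rw [hL]; push_cast; ring
  have hC' := hC z (L * (H * F)) (hz0 ▸ h0.trans hEL) hlast fun i hi => (hzm i hi).trans hEL
  rw [hz0] at hC'
  exact bvNorm_le_mul (by push_cast; ring) (h0.trans hEL) hC'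

/-! ### Passage to the infimum and equivalence of norms -/

lemma equivNorms_of_bounds {N : L1I → ℝ≥0∞} {a : ℝ} (ha : 0 < a) (K : NNReal)
    (hK : ∀ u, bvNorm u ≤ K * N u) (hN : ∀ u, N u ≤ ‖u‖ₑ + ENNReal.ofReal a * totalVar u) :
    EquivNorms N bvNorm := by
  have hpos : (0 : ℝ) < K + 1 := by positivity
  refine ⟨(K + 1 : ℝ)⁻¹, 1 + a, inv_pos.2 hpos, by linarith, fun u => ⟨?_, (hN u).trans ?_⟩⟩
  · rw [ENNReal.ofReal_inv_of_pos hpos, mul_comm, ← div_eq_mul_inv]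
    refine ENNReal.div_le_of_le_mul' ((hK u).trans ?_)
    refine mul_le_mul_left ?_ _
    rw [ENNReal.ofReal_add K.coe_nonneg zero_le_one, ENNReal.ofReal_coe_nnreal]
    exact le_self_add
  · rw [bvNorm, mul_add, ENNReal.ofReal_add zero_le_one ha.le, ENNReal.ofReal_one]
    gcongr
    · exact le_mul_of_one_le_left' le_self_add
    · exact le_add_self

lemma EquivNorms.lt_top_iff {N N' : L1I → ℝ≥0∞} (h : EquivNorms N N') (u : L1I) :
    N u < ⊤ ↔ N' u < ⊤ := by
  obtain ⟨c, C, hc, -, h⟩ := h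
  refine ⟨fun hu => ?_, fun hu => (h u).2.trans_lt (ENNReal.mul_lt_top ENNReal.ofReal_lt_top hu)⟩
  by_contra h'
  rw [not_lt, top_le_iff] at h'
  have := (h u).1.trans_lt hu
  simp [h', ENNReal.mul_top, hc] at this

/-- With the next lemma, moves the constant to the left so that the infimum over chains stands alone
on the right. `K + 1` replaces `K`, which may vanish. -/
lemma le_coe_mul_of_forall {K : NNReal} {X Y : ℝ≥0∞} (h : ((K + 1 : NNReal) : ℝ≥0∞)⁻¹ * X ≤ Y) :
    X ≤ (K + 1 : NNReal) * Y := by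
  rwa [mul_comm, ← div_eq_mul_inv, ENNReal.div_le_iff_le_mul (by simp) (by simp), mul_comm] at h

lemma inv_mul_le_of_le_coe_mul {K : NNReal} {X Y : ℝ≥0∞} (h : X ≤ K * Y) :
    ((K + 1 : NNReal) : ℝ≥0∞)⁻¹ * X ≤ Y := by
  rw [mul_comm, ← div_eq_mul_inv]
  refine ENNReal.div_le_of_le_mul' (h.trans ?_)
  gcongr
  exact le_self_add

lemma equivNorms_int (k : ℕ) (hk : 1 ≤ k) (α : Fin k → ℝ) (hα : ∀ i, 0 < α i) :
    EquivNorms (bgvIntNorm k α) bvNorm := by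
  obtain ⟨K, hK⟩ := exists_bvNorm_le_int k hk α hα
  obtain ⟨n, rfl⟩ := Nat.exists_eq_add_of_le' hk
  refine equivNorms_of_bounds (hα 0) (K + 1) (fun u => le_coe_mul_of_forall ?_)
    fun u => add_le_add le_rfl (tgvInt_le n α u)
  simp only [bgvIntNorm, tgvInt, ENNReal.add_iInf]
  refine le_iInf fun w => le_iInf fun h0 => le_iInf fun _ => le_iInf fun hl => ?_
  subst h0
  exact inv_mul_le_of_le_coe_mul (hK w hl)

lemma equivNorms_frac (k : ℕ) (hk : 1 ≤ k) {s : ℝ} (hs0 : 0 < s) (hs1 : s < 1)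
    (α : Fin (k + 1) → ℝ) (hα : ∀ i, 0 < α i) :
    EquivNorms (bgvFracNorm k s α) bvNorm := by
  obtain ⟨K, hK⟩ := exists_bvNorm_le_frac k hk hs0 hs1 α hα
  obtain ⟨n, rfl⟩ := Nat.exists_eq_add_of_le' hk
  refine equivNorms_of_bounds (hα 0) (K + 1) (fun u => le_coe_mul_of_forall ?_)
    fun u => add_le_add le_rfl (tgvFrac_le n hs0 hs1 α u)
  simp only [bgvFracNorm, tgvFrac, ENNReal.add_iInf]
  refine le_iInf fun w => le_iInf fun h0 => le_iInf fun _ => le_iInf fun _ => ?_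
  subst h0
  exact inv_mul_le_of_le_coe_mul ((hK w).trans (mul_le_mul_right (add_le_add le_rfl le_self_add) _))

/-- The fractional Poincaré inequality asks only for a continuous bounded `φ`, so `φ = 1` is allowed
and the pairing becomes the mean of `v`. -/
lemma totalVar_le_of_chain {s : ℝ} (hs0 : 0 < s) (hs1 : s < 1) (u v : L1I) :
    totalVar u ≤ derivSubMass u (s • v) + (‖∫ x in Ioo (0 : ℝ) 1, v x‖ₑ +
      gagliardo s (1 + s * (1 - s)) v) := by
  refine (totalVar_le_derivSubMass_add u (s • v)).trans ?_
  gcongr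
  have hp : 1 ≤ 1 + s * (1 - s) := by nlinarith
  have h := enorm_le_integral_mul_add_gagliardo hs0.le hp v (φ := fun _ => 1) continuous_const
    (by simp) (M := 1) (by simp)
  simp only [mul_one, ENNReal.ofReal_one, one_mul] at h
  rw [enorm_smul]
  refine (mul_le_of_le_one_left' ?_).trans h
  rw [Real.enorm_eq_ofReal hs0.le]
  exact ENNReal.ofReal_le_one.2 hs1.le

lemma exists_totalVar_le_tgvFrac_one {s : ℝ} (hs0 : 0 < s) (hs1 : s < 1) (α : Fin (1 + 1) → ℝ)
    (hα : ∀ i, 0 < α i) :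
    ∃ C : ℝ, 0 < C ∧ ∀ u : L1I, totalVar u ≤ ENNReal.ofReal C * tgvFrac 1 s α u := by
  have hss : 0 < s * (1 - s) := mul_pos hs0 (by linarith)
  obtain ⟨A, -, hA⟩ := exists_forall_le_mul
    ![α 0, α 1 * (s * (1 - s)), α 0 * (s * (1 - s))] (by
      intro i
      fin_cases i
      · exact hα 0
      · exact mul_pos (hα 1) hss
      · exact mul_pos (hα 0) hss)
  refine ⟨(A + 1 : NNReal), by positivity, fun u => ?_⟩
  rw [ENNReal.ofReal_coe_nnreal]
  refine le_coe_mul_of_forall ?_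
  rw [tgvFrac]
  refine le_iInf fun w => le_iInf fun h0 => le_iInf fun _ => le_iInf fun _ => ?_
  refine inv_mul_le_of_le_coe_mul ((totalVar_le_of_chain hs0 hs1 u (w 1)).trans ?_)
  subst h0
  have a0 := hA 0 (derivSubMass (w 0) (s • w 1))
  have a1 := hA 1 (gagliardo s (1 + s * (1 - s)) (w 1))
  have a2 := hA 2 ‖∫ x in Ioo (0 : ℝ) 1, w 1 x‖ₑ
  rw [Real.enorm_eq_ofReal_abs] at a2 ⊢
  have hm : ENNReal.ofReal (α 0 * (s * (1 - s)) * |∫ x in Ioo (0 : ℝ) 1, w 1 x|) =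
      ENNReal.ofReal (α 0 * (s * (1 - s))) * ENNReal.ofReal |∫ x in Ioo (0 : ℝ) 1, w 1 x| :=
    ENNReal.ofReal_mul (mul_pos (hα 0) hss).le
  calc _ ≤ _ := add_le_add a0 (add_le_add a2 a1)
    _ = A * ((ENNReal.ofReal (α 0) * derivSubMass (w 0) (s • w 1) +
          ENNReal.ofReal (α 1 * (s * (1 - s))) * gagliardo s (1 + s * (1 - s)) (w 1)) +
          ENNReal.ofReal (α 0 * (s * (1 - s)) * |∫ x in Ioo (0 : ℝ) 1, w 1 x|)) := by
        rw [hm]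
        simp
        ring
    _ = _ := by
        rw [Fin.sum_univ_one]
        rfl

end FracTGV

theorem mainTheorem6 (k : ℕ) (hk : 1 ≤ k) (s : ℝ) (hs0 : 0 < s) (hs1 : s < 1) :
    FracTGV.BGVInt k = FracTGV.BV ∧
    FracTGV.BGVFrac k s = FracTGV.BV ∧
    (∀ α : Fin k → ℝ, (∀ i, 0 < α i) →
      FracTGV.EquivNorms (FracTGV.bgvIntNorm k α) FracTGV.bvNorm) ∧
    (∀ α : Fin (k + 1) → ℝ, (∀ i, 0 < α i) →
      FracTGV.EquivNorms (FracTGV.bgvFracNorm k s α) FracTGV.bvNorm) ∧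
    (∀ α : Fin (1 + 1) → ℝ, (∀ i, 0 < α i) →
      ∃ C : ℝ, 0 < C ∧ ∀ u : FracTGV.L1I,
        FracTGV.totalVar u ≤ ENNReal.ofReal C * FracTGV.tgvFrac 1 s α u) := by
  refine ⟨?_, ?_, FracTGV.equivNorms_int k hk, FracTGV.equivNorms_frac k hk hs0 hs1,
    FracTGV.exists_totalVar_le_tgvFrac_one hs0 hs1⟩
  · ext u
    exact ⟨fun ⟨α, hα, h⟩ => ((FracTGV.equivNorms_int k hk α hα).lt_top_iff u).1 h,
      fun h => ⟨fun _ => 1, fun _ => one_pos,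
        ((FracTGV.equivNorms_int k hk _ fun _ => one_pos).lt_top_iff u).2 h⟩⟩
  · ext u
    exact ⟨fun ⟨α, hα, h⟩ => ((FracTGV.equivNorms_frac k hk hs0 hs1 α hα).lt_top_iff u).1 h,
      fun h => ⟨fun _ => 1, fun _ => one_pos,
        ((FracTGV.equivNorms_frac k hk hs0 hs1 _ fun _ => one_pos).lt_top_iff u).2 h⟩⟩
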